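/- Let $(A(i),C(i))$, $i=1,\dots,l$, be finitely many modes with $A(i)\in\mathbb{R}^{n\times n}$, $C(i)\in\mathbb{R}^{m\times n}$, and let $\Lambda^i\subset\mathbb{C}$ be the set of eigenvalues of $A(i)$. Let $(\sigma_k)_{k\ge 0}$ be a random sequence in $\{1,\dots,l\}$, put $(A_k,C_k)=(A(\sigma_k),C(\sigma_k))$, and consider $$x_{k+1}=A_kx_k,\qquad y_k=C_kx_k+D^ad^a_k,\qquad k\ge 0,$$ where the adversary attacks an ordered set $\{s_1,\dots,s_p\}$ of distinct sensors with inputs $d^a_k\in\mathbb{R}^p$, and $D^a\in\mathbb{R}^{m\times p}$ has entries $D^a_{uv}=1$ if $u=s_v$ and $D^a_{uv}=0$ otherwise. The adversary does not know the realized mode sequence: the sequence $(d^a_k)_{k\ge0}$ is deterministic or, more generally, random and independent of $(\sigma_k)_{k\ge0}$. Write $D^s$ for row $s$ of $D^a$, $y_k^s$ for entry $s$ of $y_k$, and $y^s(x_0^*,0,k)$ for the reading of sensor $s$ at time $k$ when the initial state is $x_0^*$ and there is no attack. The attack on sensor $s$ is called unambiguously identifiable at time $t$ if there is no $x_0^*\in\mathbb{R}^n$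 with $y^s_k=y^s(x_0^*,0,k)$ for all $0\le k\le t$, and unambiguously identifiable if it is unambiguously identifiable at all sufficiently large times $t$. Suppose that the defender follows the design recommendations: 1. $\Lambda^i\cap\Lambda^j=\emptyset$ for all $i\ne j$; 2. the mode changes only periodically, after every $\kappa$ time steps, for some $\kappa\ge 2n$: there is an integer $\varphi\ge0$ such that, almost surely, $\sigma_{k}=\sigma_{k-1}$ for every $k\ge1$ for which $\kappa$ does not divide $k+\varphi$; 3. for every sequence $(l_k)_{k\ge 0}$ in $\{1,\dots,l\}$ and every strictly increasing sequence of times $(\varrho_k)_{k\ge 0}$, $\Pr\big((A_{\varrho_k},C_{\varrho_k})=(A(l_k),C(l_k))\ \forall k\big)=0$; 4. $(A(i),C(i))$ is observable for every $i$; 5. $0\notin\Lambda^i$ for every $i$. Then for each sensor $s$, with probability $1$: if there is no $t^*$ such that $D^sd^a_k=0$ for all $k\ge t^*$, then, for every initial state $x_0\in\mathbb{R}^n$, the attack on sensor $s$ is unambiguously identifiable. -/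

import Mathlib

open MeasureTheory ProbabilityTheory

namespace MovingTarget

/-- The selection matrix `D^a` of an ordered set of attacked sensors `L = {s_1, …, s_p}`:
its `(u, v)` entry is `1` if `u = s_v` and `0` otherwise. -/
def attackMatrix {m p : ℕ} (L : Fin p ↪ Fin m) : Matrix (Fin m) (Fin p) ℝ :=
  Matrix.of fun u v => if u = L v then 1 else 0

/-- The state of `x_{k+1} = A_k x_k` started at `x₀`. -/
def state {n : ℕ} (A : ℕ → Matrix (Fin n) (Fin n) ℝ) (x₀ : Fin n → ℝ) : ℕ → Fin n → ℝ
  | 0 => x₀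
  | k + 1 => (A k).mulVec (state A x₀ k)

/-- The output `y_k = C_k x_k + e_k` of `x_{k+1} = A_k x_k` started at `x₀`, where `e_k`
(that is, `D^a d_k^a`) is the bias which the attack adds to the sensors. -/
def output {n m : ℕ} (A : ℕ → Matrix (Fin n) (Fin n) ℝ) (C : ℕ → Matrix (Fin m) (Fin n) ℝ)
    (e : ℕ → Fin m → ℝ) (x₀ : Fin n → ℝ) (k : ℕ) : Fin m → ℝ :=
  (C k).mulVec (state A x₀ k) + e k

/-- The attack with bias `e` on sensor `s` is unambiguously identifiable at time `t`: no initial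
state explains the readings of sensor `s` up to time `t` without an attack. (An attack that is
zero on sensor `s` up to time `t` never has this property, since `x₀` itself explains the
readings.) -/
def UnambiguouslyIdentifiableAt {n m : ℕ} (A : ℕ → Matrix (Fin n) (Fin n) ℝ)
    (C : ℕ → Matrix (Fin m) (Fin n) ℝ) (e : ℕ → Fin m → ℝ) (x₀ : Fin n → ℝ) (s : Fin m)
    (t : ℕ) : Prop :=
  ¬ ∃ x' : Fin n → ℝ, ∀ k ≤ t, output A C e x₀ k s = output A C 0 x' k s

/-- The attack on sensor `s` is unambiguously identifiable: from some finite time on, it is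
unambiguously identifiable at every time. (At time `0` a single scalar reading is explained by
some initial state as soon as the row of `C_0` is nonzero, so no attack could be identifiable at
literally every time.) -/
def UnambiguouslyIdentifiable {n m : ℕ} (A : ℕ → Matrix (Fin n) (Fin n) ℝ)
    (C : ℕ → Matrix (Fin m) (Fin n) ℝ) (e : ℕ → Fin m → ℝ) (x₀ : Fin n → ℝ)
    (s : Fin m) : Prop :=
  ∃ T : ℕ, ∀ t ≥ T, UnambiguouslyIdentifiableAt A C e x₀ s t

/-- The set of complex eigenvalues of a real square matrix. -/
def eigenvalues {n : ℕ} (A : Matrix (Fin n) (Fin n) ℝ) : Set ℂ :=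
  spectrum ℂ (A.map (algebraMap ℝ ℂ))

/-- The observability matrix of `(A, C)`, with block rows `C, C A, …, C A ^ (n - 1)`. -/
def observabilityMatrix {n m : ℕ} (A : Matrix (Fin n) (Fin n) ℝ)
    (C : Matrix (Fin m) (Fin n) ℝ) : Matrix (Fin n × Fin m) (Fin n) ℝ :=
  Matrix.of fun r j => (C * A ^ (r.1 : ℕ)) r.2 j

/-- The pair `(A, C)` is observable. -/
def IsObservable {n m : ℕ} (A : Matrix (Fin n) (Fin n) ℝ)
    (C : Matrix (Fin m) (Fin n) ℝ) : Prop :=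
  (observabilityMatrix A C).rank = n

/-- The design recommendations, for the modes `(A i, C i)` and the random mode sequence `σ`:
the system matrices at time `k` are `A (σ k ω)` and `C (σ k ω)`. -/
structure DesignRecommendations {n m l : ℕ} {Ω : Type*} [MeasurableSpace Ω] (μ : Measure Ω)
    (A : Fin l → Matrix (Fin n) (Fin n) ℝ) (C : Fin l → Matrix (Fin m) (Fin n) ℝ)
    (σ : ℕ → Ω → Fin l) : Prop where
  /-- Distinct modes have no common eigenvalue. -/
  disjoint_spectra : ∀ i j, i ≠ j → Disjoint (eigenvalues (A i)) (eigenvalues (A j))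
  /-- The mode can change only once every `κ ≥ 2 n` time steps, namely at the times `k` for which
  `κ` divides `k + φ`. The phase `φ` is arbitrary because time `0` is the start of the attack,
  which need not be a switching time. -/
  switching : ∃ κ φ : ℕ, 2 * n ≤ κ ∧
    ∀ᵐ ω ∂μ, ∀ k, ¬ κ ∣ (k + 1) + φ → σ (k + 1) ω = σ k ω
  /-- Any given guess of the system matrices along any given infinite subsequence of times is
  correct with probability zero. -/
  no_guess : ∀ (g : ℕ → Fin l) (ρ : ℕ → ℕ), StrictMono ρ →
    μ {ω | ∀ k, (A (σ (ρ k) ω), C (σ (ρ k) ω)) = (A (g k), C (g k))} = 0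
  /-- Every mode is observable. -/
  observable : ∀ i, IsObservable (A i) (C i)
  /-- Every `A i` is nonsingular. -/
  nonsingular : ∀ i, (0 : ℂ) ∉ eigenvalues (A i)

end MovingTarget

namespace MovingTarget

open Polynomial Matrix

/-! If explanations exist up to arbitrarily late times, then on each dwell interval the bias on
sensor `s` is a difference of two unattacked outputs, hence itself an output of the active mode. By
Cayley–Hamilton and coprimality of the characteristic polynomials, modes with disjoint spectra share
only the zero output over `2 * n` steps (`sensorRow_pow_mulVec_eq_zero`). So every interval with
nonzero bias reveals its mode. For a fixed attack that is nonzero infinitely often, the modes are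
thus forced along a fixed sequence of times, which has probability zero
(`measure_section_undetectedSet`). Fubini extends this to attacks independent of the modes
(`ae_notMem_of_indepFun`). -/

/-- The functional which reads sensor `s` of the unforced system `(A, C)` with state `w`. -/
def sensorRow {n m : ℕ} (C : Matrix (Fin m) (Fin n) ℝ) (s : Fin m) : (Fin n → ℝ) →ₗ[ℝ] ℝ :=
  LinearMap.proj s ∘ₗ C.mulVecLin

theorem sensorRow_apply {n m : ℕ} (C : Matrix (Fin m) (Fin n) ℝ) (s : Fin m) (w : Fin n → ℝ) :
    sensorRow C s w = C.mulVec w s := rfl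

/-- The readings of sensor `s` over `N` time steps, as a function of the initial state, while the
mode is constantly `(A, C)`. -/
def sensorWindow {n m : ℕ} (A : Matrix (Fin n) (Fin n) ℝ) (C : Matrix (Fin m) (Fin n) ℝ)
    (s : Fin m) (N : ℕ) : (Fin n → ℝ) →ₗ[ℝ] (Fin N → ℝ) :=
  LinearMap.pi fun j => sensorRow C s ∘ₗ (A ^ (j : ℕ)).mulVecLin

theorem sensorWindow_apply {n m : ℕ} (A : Matrix (Fin n) (Fin n) ℝ)
    (C : Matrix (Fin m) (Fin n) ℝ) (s : Fin m) (N : ℕ) (w : Fin n → ℝ) (j : Fin N) :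
    sensorWindow A C s N w j = sensorRow C s ((A ^ (j : ℕ)).mulVec w) := rfl

/-! ### Outputs of modes with disjoint spectra -/

theorem isCoprime_charpoly_of_disjoint_eigenvalues {n : ℕ} {A B : Matrix (Fin n) (Fin n) ℝ}
    (h : Disjoint (eigenvalues A) (eigenvalues B)) : IsCoprime A.charpoly B.charpoly := by
  rw [Polynomial.isCoprime_iff_aeval_ne_zero_of_isAlgClosed ℝ ℂ]
  intro z
  by_contra! hz
  have key : ∀ M : Matrix (Fin n) (Fin n) ℝ, aeval z M.charpoly = 0 → z ∈ eigenvalues M := by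
    intro M hM
    refine Matrix.mem_spectrum_of_isRoot_charpoly ?_
    rw [Matrix.charpoly_map, IsRoot.def, eval_map_algebraMap, hM]
  exact Set.disjoint_left.1 h (key A hz.1) (key B hz.2)

/-- A linear functional on real polynomials that kills the ideal of a monic polynomial and the
powers of `X` below its degree is zero. -/
theorem linearMap_polynomial_eq_zero (F : ℝ[X] →ₗ[ℝ] ℝ) {P : ℝ[X]} (hP : P.Monic)
    (hmul : ∀ r, F (P * r) = 0) (hpow : ∀ j < P.natDegree, F (X ^ j) = 0) : F = 0 := by
  -- For `P = 1` the strict degree bound on the remainder would read `0 < 0`.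
  by_cases h1 : P = 1
  · ext1 j
    ext
    simpa [h1] using hmul (monomial j 1)
  refine LinearMap.ext fun q => ?_
  rw [← modByMonic_add_div q P, map_add, hmul, add_zero,
    as_sum_range' (q %ₘ P) P.natDegree (natDegree_modByMonic_lt q hP h1), map_sum]
  refine Finset.sum_eq_zero fun j hj => ?_
  rw [← C_mul_X_pow_eq_monomial, ← smul_eq_C_mul, map_smul, hpow j (Finset.mem_range.1 hj),
    smul_zero]

/-- Two systems without a common eigenvalue have no common nonzero output over `2 n` steps. -/
theorem sensorRow_pow_mulVec_eq_zero {n m : ℕ} {A B : Matrix (Fin n) (Fin n) ℝ}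
    (h : Disjoint (eigenvalues A) (eigenvalues B)) (C D : Matrix (Fin m) (Fin n) ℝ) (s : Fin m)
    (v w : Fin n → ℝ)
    (heq : ∀ j < 2 * n, sensorRow C s ((A ^ j).mulVec v) = sensorRow D s ((B ^ j).mulVec w))
    (j : ℕ) : sensorRow C s ((A ^ j).mulVec v) = 0 := by
  let G (M : Matrix (Fin n) (Fin n) ℝ) (K : Matrix (Fin m) (Fin n) ℝ) (u : Fin n → ℝ) :
      ℝ[X] →ₗ[ℝ] ℝ :=
    sensorRow K s ∘ₗ (Matrix.mulVecBilin ℝ ℝ).flip u ∘ₗ (aeval M).toLinearMap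
  have hG : ∀ M K u q, G M K u q = sensorRow K s ((aeval M q).mulVec u) := fun _ _ _ _ => rfl
  have hF : G A C v - G B D w = 0 := by
    refine linearMap_polynomial_eq_zero _ ((A.charpoly_monic).mul B.charpoly_monic) ?_ ?_
    · intro r
      simp [hG, Matrix.aeval_self_charpoly]
    · intro j hj
      rw [(A.charpoly_monic).natDegree_mul B.charpoly_monic, charpoly_natDegree_eq_dim,
        charpoly_natDegree_eq_dim, Fintype.card_fin, ← two_mul] at hj
      simp [hG, heq j hj]
  obtain ⟨a, b, hab⟩ := isCoprime_charpoly_of_disjoint_eigenvalues h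
  -- By Bézout, `b * B.charpoly` acts as the identity through `A` and as zero through `B`, so
  -- multiplying `X ^ j` by it isolates the output of `A`.
  have hA : aeval A (b * B.charpoly) = 1 := by
    rw [← sub_eq_iff_eq_add'.2 hab.symm]
    simp [Matrix.aeval_self_charpoly]
  have := LinearMap.congr_fun hF (X ^ j * (b * B.charpoly))
  rw [LinearMap.sub_apply, hG, hG, map_mul (aeval A), hA, map_mul (aeval B), map_mul (aeval B)]
    at this
  simpa [Matrix.aeval_self_charpoly] using this

theorem eq_zero_of_mem_range_sensorWindow {n m N : ℕ} (hN : 2 * n ≤ N)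
    {A B : Matrix (Fin n) (Fin n) ℝ} (h : Disjoint (eigenvalues A) (eigenvalues B))
    {C D : Matrix (Fin m) (Fin n) ℝ} {s : Fin m} {f : Fin N → ℝ}
    (hA : f ∈ LinearMap.range (sensorWindow A C s N))
    (hB : f ∈ LinearMap.range (sensorWindow B D s N)) : f = 0 := by
  obtain ⟨v, rfl⟩ := hA
  obtain ⟨w, hw⟩ := hB
  ext j
  refine sensorRow_pow_mulVec_eq_zero h C D s v w (fun i hi => ?_) j
  exact (congrFun hw ⟨i, hi.trans_le hN⟩).symm

theorem measurableSet_range_sensorWindow {n m : ℕ} (A : Matrix (Fin n) (Fin n) ℝ)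
    (C : Matrix (Fin m) (Fin n) ℝ) (s : Fin m) (N : ℕ) :
    MeasurableSet (LinearMap.range (sensorWindow A C s N) : Set (Fin N → ℝ)) :=
  (Submodule.closed_of_finiteDimensional _).measurableSet

theorem state_add_of_const {n : ℕ} {A : ℕ → Matrix (Fin n) (Fin n) ℝ}
    {M : Matrix (Fin n) (Fin n) ℝ} {a N : ℕ} (hA : ∀ j < N, A (a + j) = M) (x : Fin n → ℝ) :
    ∀ j ≤ N, state A x (a + j) = (M ^ j).mulVec (state A x a)
  | 0, _ => by simp
  | j + 1, hj => by
    rw [← add_assoc, state, state_add_of_const hA x j (by omega), hA j (by omega),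
      Matrix.mulVec_mulVec, pow_succ']

/-- If some initial state explains the readings of sensor `s` up to time `t`, then over a window
before `t` with constant mode, the attack on sensor `s` is an output of that mode. -/
theorem window_mem_range_of_explained {n m : ℕ} {A : ℕ → Matrix (Fin n) (Fin n) ℝ}
    {C : ℕ → Matrix (Fin m) (Fin n) ℝ} {e : ℕ → Fin m → ℝ} {x₀ x' : Fin n → ℝ} {s : Fin m}
    {t a N : ℕ} (ht : a + N ≤ t) (hx : ∀ k ≤ t, output A C e x₀ k s = output A C 0 x' k s)
    (hA : ∀ j < N, A (a + j) = A a) (hC : ∀ j < N, C (a + j) = C a) :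
    (fun j : Fin N => e (a + j) s) ∈ LinearMap.range (sensorWindow (A a) (C a) s N) := by
  refine ⟨state A x' a - state A x₀ a, ?_⟩
  ext j
  have h := hx (a + j) (by omega)
  simp only [output, Pi.add_apply, Pi.zero_apply, add_zero, hC j j.2,
    state_add_of_const hA _ j j.2.le] at h
  rw [sensorWindow_apply, Matrix.mulVec_sub, map_sub, sensorRow_apply, sensorRow_apply]
  linarith

/-- If `X` and `Y` are independent, and each section of the measurable set `B` over a value of `X`
is avoided by `Y` almost surely, then `(X, Y)` avoids `B` almost surely. -/
theorem ae_notMem_of_indepFun {Ω E F : Type*} [MeasurableSpace Ω] [MeasurableSpace E]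
    [MeasurableSpace F] {μ : Measure Ω} [IsProbabilityMeasure μ] {X : Ω → E} {Y : Ω → F}
    (hX : Measurable X) (hY : Measurable Y) (hXY : IndepFun X Y μ) {B : Set (E × F)}
    (hB : MeasurableSet B) (h : ∀ x, μ {ω | (x, Y ω) ∈ B} = 0) :
    ∀ᵐ ω ∂μ, (X ω, Y ω) ∉ B := by
  have := Measure.isProbabilityMeasure_map (μ := μ) hX.aemeasurable
  have := Measure.isProbabilityMeasure_map (μ := μ) hY.aemeasurable
  have hprod := (indepFun_iff_map_prod_eq_prod_map_map hX.aemeasurable hY.aemeasurable).1 hXY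
  have hnull : μ.map (fun ω => (X ω, Y ω)) B = 0 := by
    rw [hprod, Measure.measure_prod_null hB]
    refine Filter.Eventually.of_forall fun x => ?_
    exact (Measure.map_apply hY (measurable_prodMk_left hB)).trans (h x)
  rw [Measure.map_apply (hX.prodMk hY) hB] at hnull
  rw [ae_iff]
  simp only [not_not]
  exact hnull

/-! ### Dwell intervals -/

/-- The start of the `q`-th dwell interval of length `κ`, for the phase `φ`. -/
def dwellStart (κ φ q : ℕ) : ℕ := κ * (q + φ) - φ

/-- The shift `q + φ` keeps the natural subtraction from truncating. It may skip finitely many early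
intervals, which is harmless for an attack that is nonzero infinitely often. -/
theorem dwellStart_add {κ : ℕ} (hκ : 0 < κ) (φ q : ℕ) :
    dwellStart κ φ q + φ = κ * (q + φ) := by
  have : φ ≤ κ * (q + φ) := by nlinarith
  unfold dwellStart
  omega

theorem strictMono_dwellStart {κ : ℕ} (hκ : 0 < κ) (φ : ℕ) : StrictMono (dwellStart κ φ) := by
  intro a b hab
  have ha := dwellStart_add hκ φ a
  have hb := dwellStart_add hκ φ b
  have : κ * (a + φ) < κ * (b + φ) := by gcongr
  omega

theorem exists_eq_dwellStart_add {κ : ℕ} (hκ : 0 < κ) {φ r k : ℕ} (hk : dwellStart κ φ r ≤ k) :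
    ∃ q ≥ r, ∃ j : Fin κ, k = dwellStart κ φ q + j := by
  have hr := dwellStart_add hκ φ r
  have hdiv : r + φ ≤ (k + φ) / κ := by
    rw [Nat.le_div_iff_mul_le hκ, mul_comm]
    omega
  refine ⟨(k + φ) / κ - φ, by omega, ⟨(k + φ) % κ, Nat.mod_lt _ hκ⟩, ?_⟩
  have hq := dwellStart_add hκ φ ((k + φ) / κ - φ)
  rw [Nat.sub_add_cancel (by omega)] at hq
  have := Nat.div_add_mod (k + φ) κ
  simp only
  omega

theorem const_on_dwell {S : Type*} {κ : ℕ} (hκ : 0 < κ) {φ : ℕ} {σ : ℕ → S}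
    (hσ : ∀ k, ¬ κ ∣ (k + 1) + φ → σ (k + 1) = σ k) (q : ℕ) :
    ∀ j < κ, σ (dwellStart κ φ q + j) = σ (dwellStart κ φ q)
  | 0, _ => rfl
  | j + 1, hj => by
    rw [← const_on_dwell hκ hσ q j (by omega), ← add_assoc]
    refine hσ _ fun hdvd => ?_
    rw [show dwellStart κ φ q + j + 1 + φ = κ * (q + φ) + (j + 1) by
      have := dwellStart_add hκ φ q
      omega, Nat.dvd_add_right (dvd_mul_right _ _)] at hdvd
    exact absurd (Nat.le_of_dvd (by omega) hdvd) (by omega)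

/-! ### The exceptional set and its nullity -/

/-- The attack signals and mode sequences for which the attack is nonzero infinitely often and is,
over each dwell interval, an output of sensor `s` in the active mode. -/
def undetectedSet {n m l : ℕ} (A : Fin l → Matrix (Fin n) (Fin n) ℝ)
    (C : Fin l → Matrix (Fin m) (Fin n) ℝ) (s : Fin m) (κ φ : ℕ) :
    Set ((ℕ → ℝ) × (ℕ → Fin l)) :=
  {z | (∀ t, ∃ k ≥ t, z.1 k ≠ 0) ∧ ∀ q, (fun j : Fin κ => z.1 (dwellStart κ φ q + j)) ∈
    LinearMap.range (sensorWindow (A (z.2 (dwellStart κ φ q))) (C (z.2 (dwellStart κ φ q))) s κ)}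

theorem measurableSet_undetectedSet {n m l : ℕ} (A : Fin l → Matrix (Fin n) (Fin n) ℝ)
    (C : Fin l → Matrix (Fin m) (Fin n) ℝ) (s : Fin m) (κ φ : ℕ) :
    MeasurableSet (undetectedSet A C s κ φ) := by
  -- Splitting over the finitely many values of the active mode makes the range independent of `z`.
  have hmode : undetectedSet A C s κ φ = {z | (∀ t, ∃ k, k ≥ t ∧ z.1 k ≠ 0) ∧
      ∀ q, ∃ i, z.2 (dwellStart κ φ q) = i ∧ (fun j : Fin κ => z.1 (dwellStart κ φ q + j)) ∈
        (LinearMap.range (sensorWindow (A i) (C i) s κ) : Set (Fin κ → ℝ))} := by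
    ext z
    simp [undetectedSet]
  rw [hmode]
  simp only [Set.ofPred_and, Set.ofPred_forall, Set.ofPred_exists]
  refine MeasurableSet.inter (MeasurableSet.iInter fun t => ?_) (MeasurableSet.iInter fun q => ?_)
  · refine MeasurableSet.iUnion fun k => MeasurableSet.inter (.const _) ?_
    exact ((measurable_pi_apply k).comp measurable_fst) (measurableSet_singleton 0).compl
  · refine MeasurableSet.iUnion fun i => MeasurableSet.inter ?_ ?_
    · have hf : Measurable fun z : (ℕ → ℝ) × (ℕ → Fin l) => z.2 (dwellStart κ φ q) :=
        (measurable_pi_apply _).comp measurable_snd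
      exact hf (measurableSet_singleton i)
    · have hf : Measurable fun z : (ℕ → ℝ) × (ℕ → Fin l) =>
          fun j : Fin κ => z.1 (dwellStart κ φ q + j) :=
        measurable_pi_lambda _ fun j => (measurable_pi_apply _).comp measurable_fst
      exact hf (measurableSet_range_sensorWindow (A i) (C i) s κ)

/-- For a fixed attack signal, the modes are determined at infinitely many times by the attack
being undetected. -/
theorem measure_section_undetectedSet {n m l : ℕ} {Ω : Type*} [MeasurableSpace Ω]
    {μ : Measure Ω} {A : Fin l → Matrix (Fin n) (Fin n) ℝ}
    {C : Fin l → Matrix (Fin m) (Fin n) ℝ} {σ : ℕ → Ω → Fin l}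
    (hdesign : DesignRecommendations μ A C σ) (s : Fin m) {κ : ℕ} (hκ : 0 < κ)
    (hn : 2 * n ≤ κ) (φ : ℕ) (a : ℕ → ℝ) :
    μ {ω | (a, fun k => σ k ω) ∈ undetectedSet A C s κ φ} = 0 := by
  rcases Set.eq_empty_or_nonempty {ω | (a, fun k => σ k ω) ∈ undetectedSet A C s κ φ} with
    h | ⟨ω₀, hne, hω₀⟩
  · rw [h, measure_empty]
  let p : ℕ → Prop := fun q => (fun j : Fin κ => a (dwellStart κ φ q + j)) ≠ 0
  have hp : (Set.ofPred p).Infinite := by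
    refine Set.infinite_of_forall_exists_gt fun r => ?_
    obtain ⟨k, hk, hak⟩ := hne (dwellStart κ φ (r + 1))
    obtain ⟨q, hq, j, rfl⟩ := exists_eq_dwellStart_add hκ hk
    exact ⟨q, fun h0 => hak (congrFun h0 j), hq⟩
  -- The guess is the mode sequence of the single outcome `ω₀`, read at the starts of the intervals
  -- with nonzero attack.
  refine measure_mono_null ?_ (hdesign.no_guess
    (fun k => σ (dwellStart κ φ (Nat.nth p k)) ω₀) (fun k => dwellStart κ φ (Nat.nth p k))
    ((strictMono_dwellStart hκ φ).comp (Nat.nth_strictMono hp)))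
  rintro ω ⟨-, hω⟩ k
  have hmode : σ (dwellStart κ φ (Nat.nth p k)) ω = σ (dwellStart κ φ (Nat.nth p k)) ω₀ := by
    by_contra hij
    exact Nat.nth_mem_of_infinite hp k (eq_zero_of_mem_range_sensorWindow hn
      (hdesign.disjoint_spectra _ _ hij) (hω _) (hω₀ _))
  rw [hmode]

end MovingTarget

theorem corollary1 {n m l p : ℕ} {Ω : Type*} [MeasurableSpace Ω]
    (μ : Measure Ω) [IsProbabilityMeasure μ]
    (A : Fin l → Matrix (Fin n) (Fin n) ℝ) (C : Fin l → Matrix (Fin m) (Fin n) ℝ)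
    (σ : ℕ → Ω → Fin l) (hσ : ∀ k, Measurable (σ k))
    (hdesign : MovingTarget.DesignRecommendations μ A C σ)
    (L : Fin p ↪ Fin m) (d : ℕ → Ω → Fin p → ℝ) (hd : ∀ k, Measurable (d k))
    (hindep : IndepFun (fun ω k => d k ω) (fun ω k => σ k ω) μ)
    (s : Fin m) :
    ∀ᵐ ω ∂μ,
      (¬ ∃ t' : ℕ, ∀ k ≥ t', (MovingTarget.attackMatrix L).mulVec (d k ω) s = 0) →
        ∀ x₀ : Fin n → ℝ,
          MovingTarget.UnambiguouslyIdentifiable (fun k => A (σ k ω)) (fun k => C (σ k ω))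
            (fun k => (MovingTarget.attackMatrix L).mulVec (d k ω)) x₀ s := by
  open MovingTarget in
  obtain ⟨κ, φ, hn, hswitch⟩ := hdesign.switching
  -- For `n = 0` the bound `2 * n ≤ κ` allows `κ = 0`; here unattacked readings vanish, so any
  -- nonzero bias is exposed.
  rcases Nat.eq_zero_or_pos n with rfl | hpos
  · refine Filter.Eventually.of_forall fun ω hω x₀ => ?_
    push Not at hω
    obtain ⟨k, -, hk⟩ := hω 0
    refine ⟨k, fun t ht => ?_⟩
    rintro ⟨x', hx'⟩
    have := hx' k ht
    simp only [output, Pi.add_apply, Pi.zero_apply, Matrix.mulVec_empty, zero_add] at this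
    exact hk this
  have hκ : 0 < κ := by omega
  have hread : Measurable fun v : ℕ → Fin p → ℝ => fun k => (attackMatrix L).mulVec (v k) s := by
    have : Continuous fun v : ℕ → Fin p → ℝ => fun k => (attackMatrix L).mulVec (v k) s := by
      fun_prop
    exact this.measurable
  have hd' : Measurable fun ω k => d k ω := measurable_pi_lambda _ hd
  have hσ' : Measurable fun ω k => σ k ω := measurable_pi_lambda _ hσ
  -- `undetectedSet` does not involve `x₀`, so one null set serves all initial states.
  filter_upwards [hswitch, ae_notMem_of_indepFun (hread.comp hd') hσ'
    (hindep.comp hread measurable_id) (measurableSet_undetectedSet A C s κ φ)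
    fun a => measure_section_undetectedSet hdesign s hκ hn φ a] with ω hω hnot hio x₀
  by_contra hid
  refine hnot ⟨?_, fun q => ?_⟩
  · push Not at hio
    exact hio
  · simp only [UnambiguouslyIdentifiable, UnambiguouslyIdentifiableAt] at hid
    push Not at hid
    -- An explanation valid up to some time past the end of the `q`-th interval covers that whole
    -- interval.
    obtain ⟨t, ht, x', hx'⟩ := hid (dwellStart κ φ q + κ)
    have hconst := const_on_dwell (σ := fun k => σ k ω) hκ hω q
    exact window_mem_range_of_explained (A := fun k => A (σ k ω)) (C := fun k => C (σ k ω)) ht hx'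
      (fun j hj => congrArg A (hconst j hj)) (fun j hj => congrArg C (hconst j hj))
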